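/- **Conventions.** A simplicial complex $\Gamma$ with finite vertex set $V=V(\Gamma)$ is a collection of subsets of $V$ (the faces) that is closed under inclusion. It has dimension $d-1$ if the maximum cardinality of a face is $d$, and $f_i(\Gamma)$ is the number of faces with $i+1$ elements. For $W\subseteq V$, the induced subcomplex $\Gamma[W]$ has vertex set $W$ and faces $\{F\in\Gamma : F\subseteq W\}$. For a face $F\in\Gamma$, the link $\mathrm{lk}_\Gamma(F)$ has vertex set $V\setminus F$ and faces $\{G\setminus F : F\subseteq G\in\Gamma\}$. For a field $\mathbf k$, $\tilde H_i(\,\cdot\,;\mathbf k)$ is reduced simplicial homology, and $$\mathrm{gr}_{p-1}(\Gamma)=\min\{|W| : W\subseteq V\setminus F,\ \tilde H_{p-1}(\mathrm{lk}_\Gamma(F)[W];\mathbf k)\neq 0\text{ for some face } F\in\Gamma\ (F=\emptyset\text{ allowed})\},$$ with $\mathrm{gr}_{p-1}(\Gamma)=\infty$ if there is no such $W$. For $r\ge 2$ let $a_{2,r,i}=1+\frac1r+\dots+\frac1{r^{i-1}}$ for $i\ge1$, $a_{p,r,p-1}=p-1$ for $p\geq 3$, and $a_{p,r,i}=\frac12a_{p-1,r,i-1}+\frac12a_{p,r,i-1}+1$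 for $p\ge3$, $i\ge p$. **Theorem.** Let $p\ge2$ and $d\ge0$ be integers. Then $p-\frac1{2^{p-1}}=a_{p,2,p}$, and there is a constant $C_{p,d}$, depending only on $p$ and $d$, such that for every field $\mathbf k$ and every $(d-1)$-dimensional simplicial complex $\Gamma$ with $n$ vertices whose girth over $\mathbf k$ satisfies $\mathrm{gr}_{p-1}(\Gamma)>2p$, $$f_{p-1}(\Gamma)\le C_{p,d}\,n^{\,p-\frac1{2^{p-1}}}=C_{p,d}\,n^{\,a_{p,2,p}}.$$ -/

import Mathlib

/-- The quotient `Z / (Z ∩ B)` for submodules `Z`, `B` of a module; it is `Z / B` if `B ≤ Z`. -/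
abbrev Subquotient {R M : Type*} [Ring R] [AddCommGroup M] [Module R M] (Z B : Submodule R M) :=
  Z ⧸ B.submoduleOf Z

theorem nontrivial_subquotient_iff {R M : Type*} [Ring R] [AddCommGroup M] [Module R M]
    (Z B : Submodule R M) : Nontrivial (Subquotient Z B) ↔ ¬ Z ≤ B := by
  rw [Submodule.Quotient.nontrivial_iff, Ne, Submodule.submoduleOf_eq_top]

/-- A simplicial complex with vertex set `V`: a collection of finite subsets of `V` (the faces)
that is closed under inclusion. The empty set is a face as soon as there is any face; an element
`v` of `V` need not be such that `{v}` is a face. -/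
abbrev FaceComplex (V : Type*) := LowerSet (Finset V)

namespace FaceComplex

variable {V : Type*}

/-- The set of the `i`-dimensional faces, that is, of the faces with `i + 1` vertices. -/
def facesOfDim (Γ : FaceComplex V) (i : ℤ) : Set (Finset V) :=
  {F | F ∈ Γ ∧ (F.card : ℤ) = i + 1}

/-- The face number `f_i(Γ)`. -/
noncomputable def faceNumber (Γ : FaceComplex V) (i : ℤ) : ℕ :=
  (Γ.facesOfDim i).ncard

/-- `Γ` has dimension `δ`: one less than the maximum cardinality of a face is `δ`. -/
def HasDim (Γ : FaceComplex V) (δ : ℤ) : Prop :=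
  IsGreatest {e : ℤ | ∃ F ∈ Γ, e = (F.card : ℤ) - 1} δ

/-- The induced subcomplex `Γ[W]`. -/
def induced (Γ : FaceComplex V) (W : Finset V) : FaceComplex V where
  carrier := {F | F ∈ Γ ∧ F ⊆ W}
  lower' := fun _ _ hGF hF => ⟨Γ.lower hGF hF.1, hGF.trans hF.2⟩

section Link

variable [DecidableEq V]

/-- The link of `F` in `Γ`, with faces `G \ F` for `F ⊆ G ∈ Γ`. Its vertex set is the complement
of `F`; the elements of `F` lie in no face of it. -/
def link (Γ : FaceComplex V) (F : Finset V) : FaceComplex V where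
  carrier := {H | ∃ G ∈ Γ, F ⊆ G ∧ H = G \ F}
  lower' := by
    rintro _ K hK ⟨G, hG, hFG, rfl⟩
    have hK' : K ⊆ G \ F := hK
    refine ⟨K ∪ F, Γ.lower ?_ hG, Finset.subset_union_right, ?_⟩
    · exact Finset.union_subset (hK'.trans Finset.sdiff_subset) hFG
    · ext x
      have := @hK' x
      simp only [Finset.mem_sdiff, Finset.mem_union] at this ⊢
      tauto

end Link

section Homology

variable [LinearOrder V] (k : Type*) [Field k]

/-- The sign `(-1) ^ j`, where `j` is the position of `v` in the increasing list
`v₀ < v₁ < ⋯` of the elements of `F`. -/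
def faceSign (F : Finset V) (v : V) : k :=
  (-1) ^ (F.filter (· < v)).card

/-- The augmented simplicial boundary map on the free module on the finite subsets of `V`:
`∂ [v₀, …, vₘ] = ∑ j, (-1) ^ j [v₀, …, v̂ⱼ, …, vₘ]` for `v₀ < ⋯ < vₘ`,
so that `∂ [v] = [∅]` and `∂ [∅] = 0`. -/
noncomputable def boundary : (Finset V →₀ k) →ₗ[k] (Finset V →₀ k) :=
  Finsupp.linearCombination k fun F : Finset V =>
    ∑ v ∈ F, Finsupp.single (F.erase v) (faceSign k F v)

/-- The `i`-chains of `Γ`: the linear combinations of `i`-dimensional faces. -/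
noncomputable def chains (Γ : FaceComplex V) (i : ℤ) : Submodule k (Finset V →₀ k) :=
  Finsupp.supported k k (Γ.facesOfDim i)

/-- The `i`-cycles of the augmented chain complex of `Γ`. -/
noncomputable def cycles (Γ : FaceComplex V) (i : ℤ) : Submodule k (Finset V →₀ k) :=
  Γ.chains k i ⊓ LinearMap.ker (boundary k)

/-- The `i`-boundaries of the augmented chain complex of `Γ`. -/
noncomputable def boundaries (Γ : FaceComplex V) (i : ℤ) : Submodule k (Finset V →₀ k) :=
  (Γ.chains k (i + 1)).map (boundary k)

theorem boundary_single (F : Finset V) (c : k) :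
    boundary k (Finsupp.single F c) =
      c • ∑ v ∈ F, Finsupp.single (F.erase v) (faceSign k F v) := by
  simp [boundary, Finsupp.linearCombination_single]

theorem faceSign_mul_swap (F : Finset V) {v w : V} (hv : v ∈ F) (h : v < w) :
    faceSign k F v * faceSign k (F.erase v) w = -(faceSign k F w * faceSign k (F.erase w) v) := by
  have h1 : (F.erase w).filter (· < v) = F.filter (· < v) := by
    ext x
    simp only [Finset.mem_filter, Finset.mem_erase]
    constructor
    · tauto
    · rintro ⟨hx, hxv⟩
      exact ⟨⟨(hxv.trans h).ne, hx⟩, hxv⟩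
  have h2 : (F.erase v).filter (· < w) = (F.filter (· < w)).erase v := by
    ext x
    simp only [Finset.mem_filter, Finset.mem_erase]
    tauto
  have h3 : v ∈ F.filter (· < w) := by simp [hv, h]
  unfold faceSign
  rw [h1, h2, ← Finset.card_erase_add_one h3, pow_succ]
  ring

theorem boundary_boundary (x : Finset V →₀ k) : boundary k (boundary k x) = 0 := by
  induction x using Finsupp.induction_linear with
  | zero => simp
  | add f g hf hg => simp [hf, hg]
  | single F c =>
    rw [boundary_single, map_smul, map_sum]
    simp only [boundary_single, Finset.smul_sum, Finsupp.smul_single, smul_eq_mul]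
    rw [Finset.sum_sigma']
    refine Finset.sum_involution (fun a _ => ⟨a.2, a.1⟩) ?_ ?_ ?_ ?_
    · rintro ⟨v, w⟩ h
      simp only [Finset.mem_sigma, Finset.mem_erase] at h
      obtain ⟨hv, hwv, hw⟩ := h
      have key : faceSign k F v * faceSign k (F.erase v) w
          = -(faceSign k F w * faceSign k (F.erase w) v) := by
        rcases lt_or_gt_of_ne hwv with hlt | hlt
        · rw [faceSign_mul_swap k F hw hlt, neg_neg]
        · exact faceSign_mul_swap k F hv hlt
      simp only
      rw [Finset.erase_right_comm, ← Finsupp.single_add, key]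
      simp
    · rintro ⟨v, w⟩ h _ heq
      simp only [Finset.mem_sigma, Finset.mem_erase] at h
      simp only [Sigma.mk.injEq, heq_eq_eq] at heq
      exact h.2.1 heq.1
    · rintro ⟨v, w⟩ h
      simp only [Finset.mem_sigma, Finset.mem_erase] at h ⊢
      exact ⟨h.2.2, Ne.symm h.2.1, h.1⟩
    · rintro ⟨v, w⟩ _
      rfl

/-- Every boundary is a cycle. -/
theorem boundaries_le_cycles (Γ : FaceComplex V) (i : ℤ) : Γ.boundaries k i ≤ Γ.cycles k i := by
  rintro _ ⟨x, hx, rfl⟩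
  refine ⟨?_, boundary_boundary k x⟩
  rw [boundary, Finsupp.linearCombination_apply]
  refine Submodule.sum_mem _ fun F hF => Submodule.smul_mem _ _ (Submodule.sum_mem _ fun v hv => ?_)
  obtain ⟨hFΓ, hcard⟩ := (Finsupp.mem_supported k x).1 hx hF
  refine Finsupp.single_mem_supported k _ ⟨Γ.lower (Finset.erase_subset v F) hFΓ, ?_⟩
  have := Finset.card_erase_add_one hv
  omega

/-- The `i`-th reduced simplicial homology `H̃ᵢ(Γ; k)`: cycles modulo boundaries. -/
abbrev ReducedHomology (Γ : FaceComplex V) (i : ℤ) :=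
  Subquotient (Γ.cycles k i) (Γ.boundaries k i)

/-- The `i`-girth `gr_i(Γ)` over `k`: the least `|W|` such that `H̃ᵢ(lk_Γ(F)[W]; k) ≠ 0` for some
face `F` of `Γ` and some set `W` of vertices of the link of `F`; it is `⊤` if there is none. -/
noncomputable def girth (Γ : FaceComplex V) (i : ℤ) : ℕ∞ :=
  sInf {m : ℕ∞ | ∃ F ∈ Γ, ∃ W : Finset V, Disjoint W F ∧
    Nontrivial (((Γ.link F).induced W).ReducedHomology k i) ∧ m = (W.card : ℕ∞)}

end Homology

end FaceComplex

/-- The exponents `a_{p,r,i}`, defined for `p ≥ 2` and `i ≥ p - 1` by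
`a_{2,r,i} = 1 + 1/r + ⋯ + 1/r^(i-1)`, `a_{p,r,p-1} = p - 1` and
`a_{p,r,i} = a_{p-1,r,i-1} / 2 + a_{p,r,i-1} / 2 + 1` for `p ≥ 3`, `i ≥ p`.
The values outside this range are irrelevant. -/
noncomputable def girthExponent (r : ℕ) : ℕ → ℕ → ℝ
  | 0, _ => 0
  | 1, _ => 0
  | 2, i => ∑ j ∈ Finset.range i, 1 / (r : ℝ) ^ j
  | p + 3, 0 => (p : ℝ) + 2
  | p + 3, i + 1 =>
    if i + 1 ≤ p + 2 then (p : ℝ) + 2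
    else girthExponent r (p + 2) i / 2 + girthExponent r (p + 3) i / 2 + 1

namespace FaceComplex

/-! Let X(i,Q,m) be the set of m-element faces S disjoint from Q with nonzero i-th reduced homology
of lk(S)[Q] (`homologyFaces`). The p-element faces lie in X(-1,∅,p), and the girth hypothesis
empties X(p-1,Q,m) whenever |Q| ≤ 2p, so bounds are carried down from degree i+1 to degree i.

Two facts carry them. Dropping a vertex v from a member of X(i,Q,m+1) leaves a member of X(i,Q,m) or
of X(i+1,Q∪{v},m) (`homologyFaces_of_insert`). If S∪{v} and S∪{w} have the same link on Q, then
either S is in X(i+1,Q∪{v,w},m), by suspension, or S∪{v,w} is in X(i,Q,m+2)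
(`homologyFaces_of_insert_insert`).

As |Q| is bounded, few links on Q are possible. With N vertices and a bound A in degree i+1,
Cauchy–Schwarz bounds the squared number of incidences between X(i,Q,m) and X(i,Q,m+1) by a constant
times |X(i,Q,m)|·(|X(i,Q,m+1)| + N²A + |X(i,Q,m+2)|) (`sq_sum_card_upperNeighbors_le`). Dividing
|X(i,Q,σ+j)| by N^σ t^j gives a recursion with bounded solutions, because faces have at most d
elements (`exists_sequence_bound`). Each degree step replaces t by √(Nt), so p-1 steps lead from t =
1 to N^(1-1/2^(p-1)); degree -1 with j = 1 is the theorem. -/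

theorem supported_mono_of_forall {V : Type*} (k : Type*) [Field k] {A B : Set (Finset V)} {x : Finset V →₀ k}
    (hx : x ∈ Finsupp.supported k k A) (h : ∀ F ∈ A, F ∈ B) : x ∈ Finsupp.supported k k B :=
  Finsupp.supported_mono h hx

/-! ### Contraction and cone operators on chains -/

section ChainOperators

variable {V : Type*} [LinearOrder V] (k : Type*) [Field k]

/-- The contraction of chains by a vertex `v`, which removes `v` with the sign it has in the
boundary map and kills the faces that do not contain `v`. -/
noncomputable def contract (v : V) : (Finset V →₀ k) →ₗ[k] (Finset V →₀ k) :=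
  Finsupp.linearCombination k fun F : Finset V =>
    if v ∈ F then Finsupp.single (F.erase v) (faceSign k F v) else 0

/-- The cone over chains with apex `v`; it kills the faces that contain `v`. -/
noncomputable def cone (v : V) : (Finset V →₀ k) →ₗ[k] (Finset V →₀ k) :=
  Finsupp.linearCombination k fun F : Finset V =>
    if v ∈ F then 0 else Finsupp.single (insert v F) (faceSign k F v)

theorem contract_single (v : V) (F : Finset V) (c : k) :
    contract k v (Finsupp.single F c) =
      c • if v ∈ F then Finsupp.single (F.erase v) (faceSign k F v) else 0 := by
  simp [contract, Finsupp.linearCombination_single]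

theorem cone_single (v : V) (F : Finset V) (c : k) :
    cone k v (Finsupp.single F c) =
      c • if v ∈ F then 0 else Finsupp.single (insert v F) (faceSign k F v) := by
  simp [cone, Finsupp.linearCombination_single]

theorem faceSign_mul_self (F : Finset V) (v : V) : faceSign k F v * faceSign k F v = 1 := by
  unfold faceSign
  rw [← mul_pow]
  simp

theorem faceSign_erase_self (F : Finset V) (v : V) : faceSign k (F.erase v) v = faceSign k F v := by
  unfold faceSign
  congr 2
  ext x
  simp only [Finset.mem_filter, Finset.mem_erase]
  exact ⟨fun h => ⟨h.1.2, h.2⟩, fun h => ⟨⟨h.2.ne, h.1⟩, h.2⟩⟩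

theorem faceSign_insert_self (F : Finset V) (v : V) :
    faceSign k (insert v F) v = faceSign k F v := by
  rw [← faceSign_erase_self, Finset.erase_insert_eq_erase, faceSign_erase_self]

theorem faceSign_mul_comm (F : Finset V) {v w : V} (hv : v ∈ F) (hw : w ∈ F) (h : v ≠ w) :
    faceSign k F v * faceSign k (F.erase v) w = -(faceSign k F w * faceSign k (F.erase w) v) := by
  rcases lt_or_gt_of_ne h with h | h
  · exact faceSign_mul_swap k F hv h
  · rw [faceSign_mul_swap k F hw h, neg_neg]

theorem faceSign_insert_mul (F : Finset V) {v w : V} (hv : v ∉ F) (hw : w ∈ F) :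
    faceSign k F v * faceSign k (insert v F) w = -(faceSign k F w * faceSign k (F.erase w) v) := by
  have hne : v ≠ w := fun h => hv (h ▸ hw)
  have h1 := faceSign_mul_comm k (insert v F) (Finset.mem_insert_self v F)
    (Finset.mem_insert_of_mem hw) hne
  rw [faceSign_insert_self, Finset.erase_insert hv, Finset.erase_insert_of_ne hne,
    faceSign_insert_self] at h1
  have h2 := faceSign_mul_self k (insert v F) w
  have h3 := faceSign_mul_self k F w
  linear_combination (faceSign k (insert v F) w * faceSign k F w) * h1 -
    (faceSign k (F.erase w) v * faceSign k F w) * h2 -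
    (faceSign k F v * faceSign k (insert v F) w) * h3

/-- Removing v and then another vertex, or in the opposite order, gives opposite signs. -/
theorem contract_boundary (v : V) (x : Finset V →₀ k) :
    contract k v (boundary k x) = -boundary k (contract k v x) := by
  induction x using Finsupp.induction_linear with
  | zero => simp
  | add f g hf hg => simp only [map_add, hf, hg, neg_add]
  | single F c =>
    rw [boundary_single, contract_single, map_smul, map_smul, map_sum, ← smul_neg]
    congr 1
    simp only [contract_single]
    by_cases hv : v ∈ F
    · rw [if_pos hv, boundary_single, ← Finset.add_sum_erase F _ hv, if_neg (by simp), smul_zero,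
        zero_add, Finset.smul_sum, ← Finset.sum_neg_distrib]
      refine Finset.sum_congr rfl fun w hw => ?_
      obtain ⟨hwv, hw⟩ := Finset.mem_erase.1 hw
      rw [if_pos (Finset.mem_erase.2 ⟨hwv.symm, hv⟩), Finsupp.smul_single, Finsupp.smul_single,
        smul_eq_mul, smul_eq_mul, faceSign_mul_comm k F hw hv hwv, Finset.erase_right_comm,
        Finsupp.single_neg]
    · rw [if_neg hv, map_zero, neg_zero]
      refine Finset.sum_eq_zero fun w _ => ?_
      rw [if_neg fun h => hv (Finset.mem_of_mem_erase h), smul_zero]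

theorem boundary_cone (v : V) (x : Finset V →₀ k) :
    boundary k (cone k v x) = x - cone k v (boundary k x) := by
  rw [eq_sub_iff_add_eq]
  induction x using Finsupp.induction_linear with
  | zero => simp
  | add f g hf hg => rw [map_add, map_add, map_add, map_add, add_add_add_comm, hf, hg]
  | single F c =>
    rw [boundary_single, cone_single, map_smul, map_smul, map_sum, ← smul_add]
    simp only [cone_single]
    -- Factors the scalar c out of both sides, leaving an identity for a single face.
    rw [← mul_one c, ← smul_eq_mul, ← Finsupp.smul_single, smul_eq_mul, mul_one]
    congr 1
    by_cases hv : v ∈ F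
    · rw [if_pos hv, map_zero, zero_add, ← Finset.add_sum_erase F _ hv, if_neg (by simp),
        Finset.insert_erase hv, faceSign_erase_self, Finsupp.smul_single, smul_eq_mul,
        faceSign_mul_self, Finset.sum_eq_zero, add_zero]
      intro w hw
      rw [if_pos (Finset.mem_erase.2 ⟨(Finset.ne_of_mem_erase hw).symm, hv⟩), smul_zero]
    · rw [if_neg hv, boundary_single, Finset.sum_insert hv, Finset.erase_insert hv,
        faceSign_insert_self, smul_add, Finsupp.smul_single, smul_eq_mul, faceSign_mul_self,
        add_assoc, Finset.smul_sum, ← Finset.sum_add_distrib, Finset.sum_eq_zero, add_zero]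
      intro w hw
      have hne : v ≠ w := fun h => hv (h ▸ hw)
      rw [if_neg fun h => hv (Finset.mem_of_mem_erase h), Finset.erase_insert_of_ne hne,
        Finsupp.smul_single, Finsupp.smul_single, smul_eq_mul, smul_eq_mul,
        faceSign_insert_mul k F hv hw, ← Finsupp.single_add, neg_add_cancel, Finsupp.single_zero]

/-- The right side is the part of x supported on faces avoiding v, as cone after contraction is the
part on faces containing v. -/
theorem contract_cone (v : V) (x : Finset V →₀ k) :
    contract k v (cone k v x) = x - cone k v (contract k v x) := by
  rw [eq_sub_iff_add_eq]
  induction x using Finsupp.induction_linear with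
  | zero => simp
  | add f g hf hg => rw [map_add, map_add, map_add, map_add, add_add_add_comm, hf, hg]
  | single F c =>
    rw [contract_single, cone_single, map_smul, map_smul, ← smul_add]
    rw [← mul_one c, ← smul_eq_mul, ← Finsupp.smul_single, smul_eq_mul, mul_one]
    congr 1
    by_cases hv : v ∈ F
    · rw [if_pos hv, if_pos hv, map_zero, zero_add, cone_single, if_neg (by simp),
        Finset.insert_erase hv, faceSign_erase_self, Finsupp.smul_single, smul_eq_mul,
        faceSign_mul_self]
    · rw [if_neg hv, if_neg hv, map_zero, add_zero, contract_single, if_pos (by simp),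
        Finset.erase_insert hv, faceSign_insert_self, Finsupp.smul_single, smul_eq_mul,
        faceSign_mul_self]

theorem contract_mem_supported {v : V} {A : Set (Finset V)} {x : Finset V →₀ k}
    (hx : x ∈ Finsupp.supported k k A) :
    contract k v x ∈ Finsupp.supported k k {F | v ∉ F ∧ insert v F ∈ A} := by
  rw [contract, Finsupp.linearCombination_apply]
  refine Submodule.sum_mem _ fun F hF => Submodule.smul_mem _ _ ?_
  split_ifs with h
  · refine Finsupp.single_mem_supported k _ ⟨Finset.notMem_erase v F, ?_⟩
    rw [Finset.insert_erase h]
    exact (Finsupp.mem_supported k x).1 hx hF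
  · exact Submodule.zero_mem _

theorem cone_mem_supported {v : V} {A : Set (Finset V)} {x : Finset V →₀ k}
    (hx : x ∈ Finsupp.supported k k A) :
    cone k v x ∈ Finsupp.supported k k {F | v ∈ F ∧ F.erase v ∈ A} := by
  rw [cone, Finsupp.linearCombination_apply]
  refine Submodule.sum_mem _ fun F hF => Submodule.smul_mem _ _ ?_
  split_ifs with h
  · exact Submodule.zero_mem _
  · refine Finsupp.single_mem_supported k _ ⟨Finset.mem_insert_self v F, ?_⟩
    rw [Finset.erase_insert h]
    exact (Finsupp.mem_supported k x).1 hx hF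

theorem contract_eq_zero {v : V} {A : Set (Finset V)} {x : Finset V →₀ k}
    (hx : x ∈ Finsupp.supported k k A) (hA : ∀ F ∈ A, v ∉ F) : contract k v x = 0 := by
  rw [contract, Finsupp.linearCombination_apply]
  refine Finset.sum_eq_zero fun F hF => ?_
  dsimp only
  rw [if_neg (hA F ((Finsupp.mem_supported k x).1 hx hF)), smul_zero]

end ChainOperators

/-! ### Homology of links of one and of two vertices -/

section VertexLinks

variable {V : Type*}

theorem mem_induced {Γ : FaceComplex V} {W F : Finset V} : F ∈ Γ.induced W ↔ F ∈ Γ ∧ F ⊆ W :=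
  Iff.rfl

theorem mem_facesOfDim {Γ : FaceComplex V} {i : ℤ} {F : Finset V} :
    F ∈ Γ.facesOfDim i ↔ F ∈ Γ ∧ (F.card : ℤ) = i + 1 :=
  Iff.rfl

theorem mem_link [DecidableEq V] {Γ : FaceComplex V} {S F : Finset V} :
    F ∈ Γ.link S ↔ Disjoint F S ∧ F ∪ S ∈ Γ := by
  constructor
  · rintro ⟨G, hG, hSG, rfl⟩
    exact ⟨Finset.sdiff_disjoint, by rwa [Finset.sdiff_union_of_subset hSG]⟩
  · rintro ⟨hd, h⟩
    exact ⟨F ∪ S, h, Finset.subset_union_right, (Finset.union_sdiff_cancel_right hd).symm⟩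

theorem mem_link_singleton [DecidableEq V] {Γ : FaceComplex V} {v : V} {F : Finset V} :
    F ∈ Γ.link {v} ↔ v ∉ F ∧ insert v F ∈ Γ := by
  rw [mem_link, Finset.disjoint_singleton_right, Finset.union_singleton]

theorem link_insert [DecidableEq V] (Γ : FaceComplex V) {S : Finset V} {v : V} (hv : v ∉ S) :
    Γ.link (insert v S) = (Γ.link S).link {v} := by
  ext F
  change F ∈ Γ.link (insert v S) ↔ F ∈ (Γ.link S).link {v}
  rw [mem_link_singleton, mem_link, mem_link, Finset.disjoint_insert_right,
    Finset.disjoint_insert_left, Finset.union_insert, Finset.insert_union]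
  tauto

variable [LinearOrder V] (k : Type*) [Field k]

/-- `Γ` has a nonzero `i`-th reduced homology group. -/
def HasHomology (Γ : FaceComplex V) (i : ℤ) : Prop :=
  ∃ z ∈ Γ.cycles k i, z ∉ Γ.boundaries k i

theorem hasHomology_iff (Γ : FaceComplex V) (i : ℤ) :
    Γ.HasHomology k i ↔ Nontrivial (Γ.ReducedHomology k i) := by
  rw [nontrivial_subquotient_iff, SetLike.not_le_iff_exists, HasHomology]

/-- A homology class of the link of a vertex `v` survives in the deletion of `v`, or it gives
rise to a class in the next dimension. -/
theorem hasHomology_of_link_vertex {Δ : FaceComplex V} {v : V} {Q : Finset V} {i : ℤ}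
    (hv : v ∉ Q) (h : ((Δ.link {v}).induced Q).HasHomology k i) :
    (Δ.induced Q).HasHomology k i ∨ (Δ.induced (insert v Q)).HasHomology k (i + 1) := by
  obtain ⟨e, ⟨hec, hez⟩, heb⟩ := h
  replace hez : boundary k e = 0 := hez
  by_contra! hcon
  simp only [HasHomology, not_exists, not_and, not_not] at hcon
  obtain ⟨hcon1, hcon2⟩ := hcon
  obtain ⟨b, hb, hbe⟩ := hcon1 e ⟨supported_mono_of_forall k hec fun F hF => by
    simp only [mem_facesOfDim, mem_induced, mem_link_singleton] at hF ⊢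
    exact ⟨⟨Δ.lower (Finset.subset_insert v F) hF.1.1.2, hF.1.2⟩, hF.2⟩, hez⟩
  -- Both the cone over e and b fill e, so their difference is a cycle. Contracting a filling c of
  -- it by v shows that e bounds in the link of v.
  obtain ⟨c, hc, hce⟩ := hcon2 (cone k v e - b) ⟨Submodule.sub_mem _
    (supported_mono_of_forall k (cone_mem_supported k hec) fun F hF => by
      simp only [Set.mem_ofPred_eq, mem_facesOfDim, mem_induced, mem_link_singleton] at hF ⊢
      obtain ⟨hvF, ⟨⟨-, h1⟩, h2⟩, h3⟩ := hF
      rw [Finset.insert_erase hvF] at h1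
      have := Finset.card_erase_add_one hvF
      exact ⟨⟨h1, Finset.subset_insert_iff.2 h2⟩, by omega⟩)
    (supported_mono_of_forall k hb fun F hF => by
      simp only [mem_facesOfDim, mem_induced] at hF ⊢
      exact ⟨⟨hF.1.1, hF.1.2.trans (Finset.subset_insert v Q)⟩, hF.2⟩), by
    change boundary k (cone k v e - b) = 0
    rw [map_sub, boundary_cone, hez, map_zero, sub_zero, hbe, sub_self]⟩
  refine heb ⟨-contract k v c, Submodule.neg_mem _ (supported_mono_of_forall k
    (contract_mem_supported k hc) fun F hF => ?_), ?_⟩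
  · simp only [Set.mem_ofPred_eq, mem_facesOfDim, mem_induced, mem_link_singleton] at hF ⊢
    obtain ⟨hvF, ⟨h1, h2⟩, h3⟩ := hF
    rw [Finset.card_insert_of_notMem hvF] at h3
    push_cast at h3
    refine ⟨⟨⟨hvF, h1⟩, ?_⟩, by omega⟩
    exact (Finset.insert_subset_insert_iff hvF).1 h2
  · rw [map_neg, ← contract_boundary, hce, map_sub, contract_cone,
      contract_eq_zero k hec fun F hF hvF => hv (hF.1.2 hvF), map_zero, sub_zero,
      contract_eq_zero k hb fun F hF hvF => hv (hF.1.2 hvF), sub_zero]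

/-- A homology class of the common link of two vertices `v` and `w` survives in the link of both
or its suspension is a homology class. -/
theorem hasHomology_of_link_eq {Δ : FaceComplex V} {v w : V} {Q : Finset V} {i : ℤ}
    (hv : v ∉ Q) (hw : w ∉ Q) (hvw : v ≠ w)
    (heq : (Δ.link {v}).induced Q = (Δ.link {w}).induced Q)
    (h : ((Δ.link {v}).induced Q).HasHomology k i) :
    (Δ.induced (insert v (insert w Q))).HasHomology k (i + 1) ∨
      (((Δ.link {v}).link {w}).induced Q).HasHomology k i := by
  obtain ⟨e, ⟨hec, hez⟩, heb⟩ := h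
  have hec' : e ∈ ((Δ.link {w}).induced Q).chains k i := heq ▸ hec
  replace hez : boundary k e = 0 := hez
  by_contra! hcon
  simp only [HasHomology, not_exists, not_and, not_not] at hcon
  obtain ⟨hcon1, hcon2⟩ := hcon
  have hcone : ∀ u : V, u ∈ insert v (insert w Q) →
      e ∈ ((Δ.link {u}).induced Q).chains k i →
      cone k u e ∈ (Δ.induced (insert v (insert w Q))).chains k (i + 1) := fun u hu heu =>
    supported_mono_of_forall k (cone_mem_supported k heu) fun F hF => by
      simp only [Set.mem_ofPred_eq, mem_facesOfDim, mem_induced, mem_link_singleton] at hF ⊢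
      obtain ⟨huF, ⟨⟨-, h1⟩, h2⟩, h3⟩ := hF
      rw [Finset.insert_erase huF] at h1
      have := Finset.card_erase_add_one huF
      refine ⟨⟨h1, ?_⟩, by omega⟩
      rw [← Finset.insert_erase huF]
      exact Finset.insert_subset hu (h2.trans ((Finset.subset_insert _ _).trans
        (Finset.subset_insert _ _)))
  -- The suspension of e. If it bounds c, contraction by v gives a chain a in the link of v with
  -- boundary -e; only its faces through w lie outside Q.
  obtain ⟨c, hc, hce⟩ := hcon1 (cone k v e - cone k w e) ⟨Submodule.sub_mem _
    (hcone v (by simp) hec) (hcone w (by simp) hec'), by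
    change boundary k (cone k v e - cone k w e) = 0
    rw [map_sub, boundary_cone, boundary_cone, hez, map_zero, map_zero, sub_self]⟩
  have hve : contract k v e = 0 := contract_eq_zero k hec fun F hF hvF => hv (hF.1.2 hvF)
  have hwe : contract k w e = 0 := contract_eq_zero k hec fun F hF hwF => hw (hF.1.2 hwF)
  have hvc : contract k v (cone k w e) = 0 :=
    contract_eq_zero k (cone_mem_supported k hec') fun F hF hvF => by
      have := hF.2.1.2 (Finset.mem_erase.2 ⟨hvw, hvF⟩)
      exact hv this
  set a := contract k v c with ha
  have hac : a ∈ ((Δ.link {v}).induced (insert w Q)).chains k (i + 1) :=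
    supported_mono_of_forall k (contract_mem_supported k hc) fun F hF => by
      simp only [Set.mem_ofPred_eq, mem_facesOfDim, mem_induced, mem_link_singleton] at hF ⊢
      obtain ⟨hvF, ⟨h1, h2⟩, h3⟩ := hF
      rw [Finset.card_insert_of_notMem hvF] at h3
      push_cast at h3
      exact ⟨⟨⟨hvF, h1⟩, (Finset.insert_subset_insert_iff hvF).1 h2⟩, by omega⟩
  have hab : boundary k a = -e := by
    rw [ha, ← neg_eq_iff_eq_neg, ← contract_boundary, hce, map_sub, contract_cone, hve, hvc]
    simp
  have hgc : contract k w a ∈ (((Δ.link {v}).link {w}).induced Q).chains k i :=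
    supported_mono_of_forall k (contract_mem_supported k hac) fun F hF => by
      rw [mem_facesOfDim, mem_induced, mem_link_singleton]
      obtain ⟨hwF, ⟨h1, h2⟩, h3⟩ := hF
      rw [Finset.card_insert_of_notMem hwF] at h3
      push_cast at h3
      exact ⟨⟨⟨hwF, h1⟩, (Finset.insert_subset_insert_iff hwF).1 h2⟩, by omega⟩
  have hgz : boundary k (contract k w a) = 0 := by
    rw [← neg_eq_zero, ← contract_boundary, hab, map_neg, hwe, neg_zero]
  obtain ⟨f, hf, hfg⟩ := hcon2 _ ⟨hgc, hgz⟩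
  -- The part of a avoiding w has boundary -e - g, where g is the contraction of a by w. Since f
  -- fills g, this chain has boundary e and lies over Q.
  refine heb ⟨-contract k w (cone k w a) - f, Submodule.sub_mem _ (Submodule.neg_mem _
    (supported_mono_of_forall k (contract_mem_supported k (cone_mem_supported k hac))
      fun F hF => ?_)) (supported_mono_of_forall k hf fun F hF => ?_), ?_⟩
  · obtain ⟨hwF, -, ⟨h1, h2⟩, h3⟩ := hF
    rw [Finset.erase_insert hwF] at h1 h2 h3
    exact ⟨⟨h1, (Finset.subset_insert_iff_of_notMem hwF).1 h2⟩, h3⟩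
  · simp only [mem_facesOfDim, mem_induced, mem_link_singleton (v := w)] at hF ⊢
    exact ⟨⟨(Δ.link {v}).lower (Finset.subset_insert w F) hF.1.1.2, hF.1.2⟩, hF.2⟩
  · rw [map_sub, map_neg, hfg, contract_cone, map_sub, boundary_cone, hab, hgz]
    simp

end VertexLinks

end FaceComplex

/-! ### Counting faces whose links carry homology -/

namespace FaceComplex

/-- The pairs in `U × U` on which `f` takes the same value. -/
def equalPairs {α β : Type*} [DecidableEq β] (U : Finset α) (f : α → β) : Finset (α × α) :=
  (U ×ˢ U).filter fun a => f a.1 = f a.2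

/-- Cauchy–Schwarz on the fibre sizes of f. -/
theorem sq_card_le_mul_card_equalPairs {α β : Type*} [DecidableEq β] (U : Finset α) (f : α → β)
    (T : Finset β) (hf : ∀ a ∈ U, f a ∈ T) :
    U.card ^ 2 ≤ T.card * (equalPairs U f).card := by
  have h1 : U.card = ∑ t ∈ T, (U.filter fun a => f a = t).card :=
    Finset.card_eq_sum_card_fiberwise hf
  have h2 : (equalPairs U f).card = ∑ t ∈ T, (U.filter fun a => f a = t).card ^ 2 := by
    rw [Finset.card_eq_sum_card_fiberwise (f := fun a => f a.1) (t := T)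
      (fun a ha => hf _ (by simp [equalPairs] at ha; exact ha.1.1))]
    refine Finset.sum_congr rfl fun t _ => ?_
    rw [sq, ← Finset.card_product]
    congr 1
    ext a
    simp only [equalPairs, Finset.mem_filter, Finset.mem_product]
    constructor
    · rintro ⟨⟨⟨h1, h2⟩, h3⟩, h4⟩
      exact ⟨⟨h1, h4⟩, h2, h3 ▸ h4⟩
    · rintro ⟨⟨h1, h2⟩, h3, h4⟩
      exact ⟨⟨⟨h1, h3⟩, h2.trans h4.symm⟩, h2⟩
  rw [h1, h2]
  exact sq_sum_le_card_mul_sum_sq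

section LinkTrace

variable {V : Type*} [DecidableEq V]

open Classical in
/-- The faces of `lk(S)[Q]`, as a finite set. -/
noncomputable def linkTrace (Γ : FaceComplex V) (Q S : Finset V) : Finset (Finset V) :=
  Q.powerset.filter fun F => F ∈ Γ.link S

theorem induced_eq_of_linkTrace_eq {Γ : FaceComplex V} {Q S T : Finset V}
    (h : Γ.linkTrace Q S = Γ.linkTrace Q T) : (Γ.link S).induced Q = (Γ.link T).induced Q := by
  classical
  ext F
  have := Finset.ext_iff.1 h F
  simp only [linkTrace, Finset.mem_filter, Finset.mem_powerset] at this
  change F ∈ (Γ.link S).induced Q ↔ F ∈ (Γ.link T).induced Q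
  rw [mem_induced, mem_induced]
  tauto

end LinkTrace

section Counting

variable {V : Type*} [Fintype V] [LinearOrder V] (k : Type*) [Field k]

open Classical in
/-- The faces `S` with `m` elements, disjoint from `Q`, for which the `i`-th reduced homology of
`lk(S)[Q]` does not vanish. -/
noncomputable def homologyFaces (Γ : FaceComplex V) (i : ℤ) (Q : Finset V) (m : ℕ) :
    Finset (Finset V) :=
  Finset.univ.filter fun S =>
    S.card = m ∧ Disjoint Q S ∧ ((Γ.link S).induced Q).HasHomology k i

theorem mem_homologyFaces {Γ : FaceComplex V} {i : ℤ} {Q : Finset V} {m : ℕ} {S : Finset V} :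
    S ∈ Γ.homologyFaces k i Q m ↔
      S.card = m ∧ Disjoint Q S ∧ ((Γ.link S).induced Q).HasHomology k i := by
  classical
  simp [homologyFaces]

theorem homologyFaces_of_insert {Γ : FaceComplex V} {i : ℤ} {Q : Finset V} {m : ℕ} {S : Finset V}
    {v : V} (hv : v ∉ S) (h : insert v S ∈ Γ.homologyFaces k i Q (m + 1)) :
    S ∈ Γ.homologyFaces k i Q m ∨ S ∈ Γ.homologyFaces k (i + 1) (insert v Q) m := by
  obtain ⟨h1, h2, h3⟩ := (mem_homologyFaces k).1 h
  rw [Finset.card_insert_of_notMem hv, Nat.add_right_cancel_iff] at h1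
  rw [Finset.disjoint_insert_right] at h2
  rw [link_insert Γ hv] at h3
  simp only [mem_homologyFaces, Finset.disjoint_insert_left]
  have := hasHomology_of_link_vertex k h2.1 h3
  tauto

theorem homologyFaces_of_insert_insert {Γ : FaceComplex V} {i : ℤ} {Q : Finset V} {m : ℕ}
    {S : Finset V} {v w : V} (hv : v ∉ S) (hw : w ∉ S) (hvw : v ≠ w)
    (hm : S.card = m)
    (h : insert v S ∈ Γ.homologyFaces k i Q (m + 1))
    (h' : insert w S ∈ Γ.homologyFaces k i Q (m + 1))
    (heq : (Γ.link (insert v S)).induced Q = (Γ.link (insert w S)).induced Q) :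
    S ∈ Γ.homologyFaces k (i + 1) (insert v (insert w Q)) m ∨
      insert w (insert v S) ∈ Γ.homologyFaces k i Q (m + 2) := by
  obtain ⟨-, h2, h3⟩ := (mem_homologyFaces k).1 h
  obtain ⟨-, h2', -⟩ := (mem_homologyFaces k).1 h'
  rw [Finset.disjoint_insert_right] at h2 h2'
  have hw' : w ∉ insert v S := by simp [hw, hvw.symm]
  rw [link_insert Γ hv] at h3
  rw [link_insert Γ hv, link_insert Γ hw] at heq
  have := hasHomology_of_link_eq k h2.1 h2'.1 hvw heq h3
  simp only [mem_homologyFaces, Finset.disjoint_insert_left, Finset.disjoint_insert_right]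
  rw [Finset.card_insert_of_notMem hw', Finset.card_insert_of_notMem hv, link_insert Γ hw',
    link_insert Γ hv]
  exact this.imp (fun h => ⟨hm, ⟨hv, hw, h2.2⟩, h⟩)
    fun h => ⟨by omega, ⟨h2'.1, h2.1, h2.2⟩, h⟩

/-- The vertices `v ∉ S` for which `insert v S` is one of the faces in `Y`. -/
def upperNeighbors (Y : Finset (Finset V)) (S : Finset V) : Finset V :=
  Finset.univ.filter fun v => v ∉ S ∧ insert v S ∈ Y


theorem mem_upperNeighbors {Y : Finset (Finset V)} {S : Finset V} {v : V} :
    v ∈ upperNeighbors Y S ↔ v ∉ S ∧ insert v S ∈ Y := by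
  simp [upperNeighbors]

/-- Each T in Y arises from at most m pairs (S, v), one for each choice of v in T. -/
theorem sum_card_upperNeighbors_le {X Y : Finset (Finset V)} {m : ℕ}
    (hY : ∀ T ∈ Y, T.card = m) : ∑ S ∈ X, (upperNeighbors Y S).card ≤ m * Y.card := by
  have h : ∑ T ∈ Y, T.card = m * Y.card := by
    rw [Finset.sum_congr rfl hY, Finset.sum_const, smul_eq_mul, mul_comm]
  rw [← h, ← Finset.card_sigma, ← Finset.card_sigma]
  refine Finset.card_le_card_of_injOn (fun a => ⟨insert a.2 a.1, a.2⟩) ?_ ?_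
  · rintro ⟨S, v⟩ ha
    simp only [Finset.coe_sigma, Set.mem_sigma_iff, Finset.mem_coe, mem_upperNeighbors] at ha ⊢
    exact ⟨ha.2.2, Finset.mem_insert_self v S⟩
  · rintro ⟨S, v⟩ ha ⟨S', v'⟩ ha' heq
    simp only [Finset.coe_sigma, Set.mem_sigma_iff, Finset.mem_coe, mem_upperNeighbors] at ha ha'
    simp only [Sigma.mk.injEq, heq_eq_eq] at heq ⊢
    obtain ⟨h1, rfl⟩ := heq
    rw [← Finset.erase_insert ha.2.1, h1, Finset.erase_insert ha'.2.1]
    simp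

/-- Delete an arbitrary vertex v from each face: either the class moves up a degree, at most A faces
for each v, or it survives and the face is counted as an incidence. -/
theorem card_homologyFaces_succ_le (Γ : FaceComplex V) (i : ℤ) (Q : Finset V) (m : ℕ) {A : ℕ}
    (hA : ∀ v, (Γ.homologyFaces k (i + 1) (insert v Q) m).card ≤ A) :
    (Γ.homologyFaces k i Q (m + 1)).card ≤ Fintype.card V * A +
      ∑ S ∈ Γ.homologyFaces k i Q m,
        (upperNeighbors (Γ.homologyFaces k i Q (m + 1)) S).card := by
  set Y := Γ.homologyFaces k i Q (m + 1)
  set X := Γ.homologyFaces k i Q m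
  have hsub : Y ⊆ (Finset.univ.sigma fun v => Γ.homologyFaces k (i + 1) (insert v Q) m).image
      (fun a : (_ : V) × Finset V => insert a.1 a.2) ∪
      (X.sigma (upperNeighbors Y)).image (fun a => insert a.2 a.1) := by
    intro T hT
    have hcard : T.card = m + 1 := ((mem_homologyFaces k).1 hT).1
    obtain ⟨v, hv⟩ : T.Nonempty := by
      rw [← Finset.card_pos]
      omega
    have hins := Finset.insert_erase hv
    rw [Finset.mem_union, Finset.mem_image, Finset.mem_image]
    rcases homologyFaces_of_insert k (Finset.notMem_erase v T) (hins.symm ▸ hT) with h | h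
    · refine Or.inr ⟨⟨T.erase v, v⟩, ?_, hins⟩
      simp only [Finset.mem_sigma, mem_upperNeighbors]
      exact ⟨h, Finset.notMem_erase v T, hins.symm ▸ hT⟩
    · exact Or.inl ⟨⟨v, T.erase v⟩, by simpa using h, hins⟩
  refine (Finset.card_le_card hsub).trans ((Finset.card_union_le _ _).trans (add_le_add ?_ ?_))
  · refine Finset.card_image_le.trans ?_
    rw [Finset.card_sigma]
    refine (Finset.sum_le_card_nsmul _ _ A fun v _ => hA v).trans ?_
    simp [Finset.card_univ]
  · refine Finset.card_image_le.trans ?_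
    rw [Finset.card_sigma]

theorem sum_card_equalPairs_le (Γ : FaceComplex V) (i : ℤ) (Q : Finset V) (m : ℕ) {A : ℕ}
    (hA : ∀ v w, (Γ.homologyFaces k (i + 1) (insert v (insert w Q)) m).card ≤ A) :
    ∑ S ∈ Γ.homologyFaces k i Q m,
      (equalPairs (upperNeighbors (Γ.homologyFaces k i Q (m + 1)) S)
        fun v => Γ.linkTrace Q (insert v S)).card ≤
      (m + 1) * (Γ.homologyFaces k i Q (m + 1)).card + Fintype.card V ^ 2 * A +
        (m + 2) ^ 2 * (Γ.homologyFaces k i Q (m + 2)).card := by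
  set X := Γ.homologyFaces k i Q m with hX
  set Y := Γ.homologyFaces k i Q (m + 1) with hY
  set Z := Γ.homologyFaces k i Q (m + 2) with hZ
  -- Off the diagonal, a pair with equal traces falls under one of the two outcomes: `P₁` when the
  -- suspension survives, `P₂` when the class passes to the link of both vertices.
  let P₁ : Finset V → Finset (V × V) := fun S =>
    Finset.univ.filter fun a => S ∈ Γ.homologyFaces k (i + 1) (insert a.1 (insert a.2 Q)) m
  let P₂ : Finset V → Finset (V × V) := fun S =>
    Finset.univ.filter fun a => a.1 ∉ S ∧ a.2 ∉ S ∧ a.1 ≠ a.2 ∧ insert a.2 (insert a.1 S) ∈ Z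
  have hle : ∀ S ∈ X, (equalPairs (upperNeighbors Y S)
      fun v => Γ.linkTrace Q (insert v S)).card ≤
        (upperNeighbors Y S).card + (P₁ S).card + (P₂ S).card := by
    intro S hS
    have hsub : equalPairs (upperNeighbors Y S) (fun v => Γ.linkTrace Q (insert v S)) ⊆
        ((upperNeighbors Y S).image fun v => (v, v)) ∪ P₁ S ∪ P₂ S := by
      rintro ⟨v, w⟩ ha
      simp only [equalPairs, Finset.mem_filter, Finset.mem_product, mem_upperNeighbors] at ha
      obtain ⟨⟨⟨hv, hvY⟩, hw, hwY⟩, heq⟩ := ha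
      simp only [Finset.mem_union, Finset.mem_image, P₁, P₂, Finset.mem_filter, Finset.mem_univ,
        true_and, mem_upperNeighbors, Prod.mk.injEq]
      by_cases hvw : v = w
      · exact Or.inl (Or.inl ⟨v, ⟨hv, hvY⟩, rfl, hvw⟩)
      · have := homologyFaces_of_insert_insert k hv hw hvw ((mem_homologyFaces k).1 hS).1 hvY hwY
          (induced_eq_of_linkTrace_eq heq)
        tauto
    refine (Finset.card_le_card hsub).trans ((Finset.card_union_le _ _).trans
      (add_le_add_left ((Finset.card_union_le _ _).trans (add_le_add_left ?_ _)) _))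
    exact Finset.card_image_le
  refine (Finset.sum_le_sum hle).trans ?_
  rw [Finset.sum_add_distrib, Finset.sum_add_distrib]
  refine add_le_add (add_le_add ?_ ?_) ?_
  · exact sum_card_upperNeighbors_le fun T hT => ((mem_homologyFaces k).1 hT).1
  · have h1 := Finset.sum_card_bipartiteAbove_eq_sum_card_bipartiteBelow (s := X)
      (t := (Finset.univ : Finset (V × V)))
      (fun S a => S ∈ Γ.homologyFaces k (i + 1) (insert a.1 (insert a.2 Q)) m)
    refine (h1.trans_le (Finset.sum_le_card_nsmul _ _ A fun a _ => ?_)).trans ?_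
    · refine (Finset.card_le_card ?_).trans (hA a.1 a.2)
      intro S hS
      exact (Finset.mem_filter.1 hS).2
    · simp [Finset.card_univ, sq]
  · have h : ∑ T ∈ Z, (T ×ˢ T).card = (m + 2) ^ 2 * Z.card := by
      rw [Finset.sum_congr rfl fun T hT => by
        rw [Finset.card_product, ((mem_homologyFaces k).1 hT).1, ← sq], Finset.sum_const,
        smul_eq_mul, mul_comm]
    rw [← h, ← Finset.card_sigma, ← Finset.card_sigma]
    -- The larger face together with the ordered pair (v, w) determines S, and each face in `Z`
    -- admits at most (m + 2)² pairs.
    refine Finset.card_le_card_of_injOn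
      (fun a => ⟨insert a.2.2 (insert a.2.1 a.1), a.2⟩) ?_ ?_
    · rintro ⟨S, v, w⟩ ha
      simp only [Finset.coe_sigma, Set.mem_sigma_iff, Finset.mem_coe, P₂, Finset.mem_filter,
        Finset.mem_product] at ha ⊢
      exact ⟨ha.2.2.2.2.2, by simp, by simp⟩
    · rintro ⟨S, v, w⟩ ha ⟨S', v', w'⟩ ha' heq
      simp only [Finset.coe_sigma, Set.mem_sigma_iff, Finset.mem_coe, P₂, Finset.mem_filter] at ha ha'
      simp only [Sigma.mk.injEq, heq_eq_eq, Prod.mk.injEq] at heq ⊢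
      obtain ⟨h1, rfl, rfl⟩ := heq
      obtain ⟨-, -, hv, hw, hvw, -⟩ := ha
      obtain ⟨-, -, hv', hw', -, -⟩ := ha'
      have h2 : w ∉ insert v S := by simp [hw, Ne.symm hvw]
      have h3 : w ∉ insert v S' := by simp [hw', Ne.symm hvw]
      have h4 : insert v S = insert v S' := by
        rw [← Finset.erase_insert h2, h1, Finset.erase_insert h3]
      refine ⟨?_, rfl, rfl⟩
      rw [← Finset.erase_insert hv, h4, Finset.erase_insert hv']

/-- Cauchy–Schwarz is used twice: over S, and for each S over the traces on Q, which are families of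
subsets of Q and hence at most 2^(2^|Q|) in number. -/
theorem sq_sum_card_upperNeighbors_le (Γ : FaceComplex V) (i : ℤ) (Q : Finset V) (m : ℕ) {A : ℕ}
    (hA : ∀ v w, (Γ.homologyFaces k (i + 1) (insert v (insert w Q)) m).card ≤ A) :
    (∑ S ∈ Γ.homologyFaces k i Q m,
      (upperNeighbors (Γ.homologyFaces k i Q (m + 1)) S).card) ^ 2 ≤
      (Γ.homologyFaces k i Q m).card * (2 ^ 2 ^ Q.card *
        ((m + 1) * (Γ.homologyFaces k i Q (m + 1)).card + Fintype.card V ^ 2 * A +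
          (m + 2) ^ 2 * (Γ.homologyFaces k i Q (m + 2)).card)) := by
  refine sq_sum_le_card_mul_sum_sq.trans (Nat.mul_le_mul_left _ ?_)
  refine le_trans ?_ (Nat.mul_le_mul_left _ (sum_card_equalPairs_le k Γ i Q m hA))
  rw [Finset.mul_sum]
  refine Finset.sum_le_sum fun S _ => ?_
  refine (sq_card_le_mul_card_equalPairs _ (fun v => Γ.linkTrace Q (insert v S))
    Q.powerset.powerset fun v _ => ?_).trans_eq ?_
  · classical
    rw [Finset.mem_powerset]
    exact Finset.filter_subset _ _
  · rw [Finset.card_powerset, Finset.card_powerset]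

theorem card_homologyFaces_le_pow (Γ : FaceComplex V) (i : ℤ) (Q : Finset V) (m : ℕ) :
    (Γ.homologyFaces k i Q m).card ≤ Fintype.card V ^ m := by
  refine le_trans ?_ (Nat.choose_le_pow (Fintype.card V) m)
  rw [← Fintype.card_finset_len, Fintype.card_subtype]
  refine Finset.card_le_card fun S hS => ?_
  simpa using ((mem_homologyFaces k).1 hS).1

/-- If S is not a face, its link has no faces at all, not even the empty one, hence no homology. -/
theorem mem_of_mem_homologyFaces {Γ : FaceComplex V} {i : ℤ} {Q : Finset V} {m : ℕ}
    {S : Finset V} (h : S ∈ Γ.homologyFaces k i Q m) : S ∈ Γ := by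
  obtain ⟨-, -, z, ⟨hz, -⟩, hz'⟩ := (mem_homologyFaces k).1 h
  by_contra hS
  have hempty : ((Γ.link S).induced Q).facesOfDim i = ∅ := by
    refine Set.eq_empty_of_forall_notMem fun F hF => hS ?_
    obtain ⟨⟨hF, -⟩, -⟩ := hF
    exact Γ.lower Finset.subset_union_right (mem_link.1 hF).2
  have hz0 : z ∈ Finsupp.supported k k (((Γ.link S).induced Q).facesOfDim i) := hz
  rw [hempty, Finsupp.supported_empty, Submodule.mem_bot] at hz0
  exact hz' (hz0 ▸ Submodule.zero_mem _)

/-- The complex lk(S)[∅] consists of the empty face alone, whose class generates degree -1. -/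
theorem mem_homologyFaces_empty {Γ : FaceComplex V} {S : Finset V} (hS : S ∈ Γ) :
    S ∈ Γ.homologyFaces k (-1) ∅ S.card := by
  refine (mem_homologyFaces k).2 ⟨rfl, Finset.disjoint_empty_left _, Finsupp.single ∅ 1,
    ⟨Finsupp.single_mem_supported k _ ⟨⟨mem_link.2 ⟨Finset.disjoint_empty_left _, ?_⟩,
      Finset.empty_subset _⟩, by simp⟩, ?_⟩, ?_⟩
  · simpa using hS
  · change boundary k _ = 0
    simp [boundary_single]
  · rintro ⟨x, hx, hx'⟩
    have hempty : ((Γ.link S).induced ∅).facesOfDim (-1 + 1) = ∅ := by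
      refine Set.eq_empty_of_forall_notMem fun F hF => ?_
      obtain ⟨⟨-, hF⟩, hc⟩ := hF
      rw [Finset.subset_empty.1 hF] at hc
      simp at hc
    have hx0 : x ∈ Finsupp.supported k k (((Γ.link S).induced ∅).facesOfDim (-1 + 1)) := hx
    rw [hempty, Finsupp.supported_empty, Submodule.mem_bot] at hx0
    rw [hx0, map_zero] at hx'
    exact one_ne_zero (Finsupp.single_eq_zero.1 hx'.symm)

theorem homologyFaces_eq_empty_of_girth {Γ : FaceComplex V} {i : ℤ} {Q : Finset V} {m : ℕ}
    (h : (Q.card : ℕ∞) < Γ.girth k i) : Γ.homologyFaces k i Q m = ∅ := by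
  refine Finset.eq_empty_of_forall_notMem fun S hS => h.not_ge (sInf_le ?_)
  exact ⟨S, mem_of_mem_homologyFaces k hS, Q, ((mem_homologyFaces k).1 hS).2.1,
    (hasHomology_iff k _ i).1 ((mem_homologyFaces k).1 hS).2.2, rfl⟩

end Counting

end FaceComplex

/-! ### A quadratic recursion with bounded solutions -/

namespace FaceComplex

/-- Descending induction on j, starting where u vanishes: a bound on u (j + 2) in terms of u (j + 1)
lets one factor u (j + 1) cancel from the quadratic inequality. -/
theorem exists_ratio_bound {c : ℝ} (hc : 1 ≤ c) (J n : ℕ) :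
    ∃ L : ℝ, 2 ≤ L ∧ ∀ C : ℝ, 1 ≤ C → ∀ u : ℕ → ℝ, (∀ j, 0 ≤ u j) → (∀ j, J < j → u j = 0) →
      (∀ j, ∃ y, 0 ≤ y ∧ u (j + 1) ≤ C + y ∧ y ^ 2 ≤ c * u j * (u (j + 1) + C + u (j + 2))) →
      ∀ j, J ≤ j + n → u (j + 1) ≤ L * max C (u j) := by
  induction n with
  | zero =>
    refine ⟨2, le_rfl, fun C hC u hu hJ _ j hj => ?_⟩
    rw [hJ (j + 1) (by omega)]
    positivity
  | succ n ih =>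
    obtain ⟨L, hL, h⟩ := ih
    have hL' : 2 ≤ 4 * c * (2 + L) := by nlinarith
    refine ⟨4 * c * (2 + L), hL', fun C hC u hu hJ hrec j hj => ?_⟩
    have hb := h C hC u hu hJ hrec (j + 1) (by omega)
    obtain ⟨y, hy, h1, h2⟩ := hrec j
    -- In the second case y exceeds u (j + 1) / 2 and the bracket is at most (2 + L) u (j + 1),
    -- which gives the new constant 4c(2 + L).
    rcases le_or_gt (u (j + 1)) (2 * C) with hle | hgt
    · calc u (j + 1) ≤ 2 * C := hle
        _ ≤ (4 * c * (2 + L)) * max C (u j) :=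
          mul_le_mul hL' (le_max_left _ _) (by linarith) (by linarith)
    · refine le_trans ?_ (mul_le_mul_of_nonneg_left (le_max_right C (u j)) (by linarith))
      rw [max_eq_right (by linarith)] at hb
      have hpos : 0 < u (j + 1) := by linarith
      have h3 : (u (j + 1) / 2) ^ 2 ≤ y ^ 2 := pow_le_pow_left₀ (by linarith) (by linarith) 2
      have h4 : c * u j * (u (j + 1) + C + u (j + 2)) ≤ c * u j * ((2 + L) * u (j + 1)) :=
        mul_le_mul_of_nonneg_left (by linarith) (mul_nonneg (by linarith) (hu j))
      refine le_of_mul_le_mul_right ?_ hpos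
      linarith

theorem exists_sequence_bound {c : ℝ} (hc : 1 ≤ c) (J : ℕ) {C : ℝ} (hC : 1 ≤ C) :
    ∃ B : ℝ, 1 ≤ B ∧ ∀ u : ℕ → ℝ, (∀ j, 0 ≤ u j) → u 0 ≤ 1 → (∀ j, J < j → u j = 0) →
      (∀ j, ∃ y, 0 ≤ y ∧ u (j + 1) ≤ C + y ∧ y ^ 2 ≤ c * u j * (u (j + 1) + C + u (j + 2))) →
      ∀ j, u j ≤ B := by
  obtain ⟨L, hL, h⟩ := exists_ratio_bound hc J J
  have hL1 : 1 ≤ L := by linarith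
  refine ⟨L ^ J * C, one_le_mul_of_one_le_of_one_le (one_le_pow₀ hL1) hC,
    fun u hu h0 hJ hrec j => ?_⟩
  have key : ∀ j, u j ≤ L ^ j * C := by
    intro j
    induction j with
    | zero => simpa using h0.trans hC
    | succ j ih =>
      refine (h C hC u hu hJ hrec j (by omega)).trans ?_
      rw [pow_succ', mul_assoc]
      refine mul_le_mul_of_nonneg_left (max_le ?_ ih) (by linarith)
      exact le_mul_of_one_le_left (by linarith) (one_le_pow₀ hL1)
  rcases le_or_gt j J with hj | hj
  · exact (key j).trans (mul_le_mul_of_nonneg_right (pow_le_pow_right₀ hL1 hj) (by linarith))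
  · rw [hJ j hj]
    positivity

/-! ### Descent through homological degrees -/

theorem card_homologyFaces_eq_zero {V : Type*} [Fintype V] [LinearOrder V] (k : Type*) [Field k]
    {Γ : FaceComplex V} {d : ℕ} (hd : ∀ F ∈ Γ, F.card ≤ d) (i : ℤ) (Q : Finset V) {m : ℕ}
    (hm : d < m) : (Γ.homologyFaces k i Q m).card = 0 := by
  rw [Finset.card_eq_zero]
  refine Finset.eq_empty_of_forall_notMem fun S hS => ?_
  have := hd S (mem_of_mem_homologyFaces k hS)
  have := ((mem_homologyFaces k).1 hS).1
  omega

universe u v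

/-- One degree step. The window for |Q| shrinks by 2 because the suspension adds two vertices to Q;
the factor N² in the hypothesis counts the pairs (v, w). -/
theorem exists_card_homologyFaces_le (d σ w : ℕ) {C₀ : ℝ} (hC₀ : 1 ≤ C₀) :
    ∃ C : ℝ, 1 ≤ C ∧ ∀ (k : Type u) [Field k] (V : Type v) [Fintype V] [LinearOrder V]
      (Γ : FaceComplex V) (i : ℤ) (t : ℝ), (∀ F ∈ Γ, F.card ≤ d) → 1 ≤ t →
      t ≤ Fintype.card V →
      (∀ (j : ℕ) (Q : Finset V), Q.card ≤ w + 2 →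
        (Fintype.card V : ℝ) ^ 2 * ((Γ.homologyFaces k (i + 1) Q (σ + j)).card : ℝ) ≤
          C₀ * ((Fintype.card V : ℝ) ^ σ * t ^ (j + 2))) →
      ∀ (j : ℕ) (Q : Finset V), Q.card ≤ w →
        ((Γ.homologyFaces k i Q (σ + j)).card : ℝ) ≤
          C * ((Fintype.card V : ℝ) ^ σ * t ^ j) := by
  set c : ℝ := 2 ^ 2 ^ w * ((d : ℝ) + 2) ^ 2 with hc
  have hd2 : (1 : ℝ) ≤ ((d : ℝ) + 2) ^ 2 := one_le_pow₀ (by linarith [d.cast_nonneg (α := ℝ)])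
  have hc1 : 1 ≤ c := one_le_mul_of_one_le_of_one_le (one_le_pow₀ one_le_two) hd2
  obtain ⟨B, hB1, hB⟩ := exists_sequence_bound hc1 d hC₀
  refine ⟨B, hB1, fun k _ V _ _ Γ i t hd ht htN hA j Q hQ => ?_⟩
  set N : ℝ := (Fintype.card V : ℝ) with hN
  have ht0 : 0 < t := by linarith
  have hN0 : 0 < N := by linarith
  have hP0 : 0 < N ^ σ := pow_pos hN0 σ
  have hden : ∀ j, 0 < N ^ σ * t ^ j := fun j => by positivity
  set x : ℕ → ℝ := fun j => ((Γ.homologyFaces k i Q (σ + j)).card : ℝ) with hx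
  have hx0 : ∀ j, 0 ≤ x j := fun j => Nat.cast_nonneg _
  set r : ℕ → ℝ := fun j => x j / (N ^ σ * t ^ j) with hr
  have hxr : ∀ j, x j = r j * (N ^ σ * t ^ j) := fun j => (div_mul_cancel₀ _ (hden j).ne').symm
  have hr0 : ∀ j, 0 ≤ r j := fun j => div_nonneg (hx0 j) (hden j).le
  change x j ≤ _
  rw [hxr]
  refine mul_le_mul_of_nonneg_right (hB r hr0 ?_ ?_ ?_ j) (hden j).le
  · rw [hr]
    refine div_le_one_of_le₀ ?_ (hden 0).le
    rw [pow_zero, mul_one]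
    have h := (Nat.cast_le (α := ℝ)).2 (card_homologyFaces_le_pow k Γ i Q σ)
    rwa [Nat.cast_pow] at h
  · intro j hj
    simp only [hr, hx, card_homologyFaces_eq_zero k hd i Q (show d < σ + j by omega)]
    simp
  intro j
  -- The largest natural number allowed by the hypothesis as a bound in degree i + 1.
  set A : ℕ := ⌊C₀ * (N ^ σ * t ^ (j + 2)) / N ^ 2⌋₊ with hAdef
  have hAle : N ^ 2 * (A : ℝ) ≤ C₀ * (N ^ σ * t ^ (j + 2)) := by
    rw [mul_comm, ← le_div_iff₀ (by positivity)]
    exact Nat.floor_le (by positivity)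
  have hAge : ∀ Q' : Finset V, Q'.card ≤ w + 2 →
      (Γ.homologyFaces k (i + 1) Q' (σ + j)).card ≤ A := fun Q' hQ' => by
    refine Nat.le_floor ?_
    rw [le_div_iff₀ (by positivity), mul_comm]
    exact hA j Q' hQ'
  have hAN : N * (A : ℝ) ≤ C₀ * (N ^ σ * t ^ (j + 1)) := by
    refine le_of_mul_le_mul_left ?_ hN0
    calc N * (N * (A : ℝ)) = N ^ 2 * A := by ring
      _ ≤ t * (C₀ * (N ^ σ * t ^ (j + 1))) := hAle.trans_eq (by ring)
      _ ≤ N * (C₀ * (N ^ σ * t ^ (j + 1))) := mul_le_mul_of_nonneg_right htN (by positivity)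
  have h1 := card_homologyFaces_succ_le k Γ i Q (σ + j) (A := A) fun v =>
    hAge _ ((Finset.card_insert_le _ _).trans (by omega))
  have h2 := sq_sum_card_upperNeighbors_le k Γ i Q (σ + j) (A := A) fun v w =>
    hAge _ ((Finset.card_insert_le _ _).trans (by
      have := Finset.card_insert_le w Q
      omega))
  set y : ℕ := ∑ S ∈ Γ.homologyFaces k i Q (σ + j),
    (upperNeighbors (Γ.homologyFaces k i Q (σ + j + 1)) S).card with hy
  have h1' : x (j + 1) ≤ N * A + y := by
    have h := (Nat.cast_le (α := ℝ)).2 h1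
    rwa [Nat.cast_add, Nat.cast_mul] at h
  have h2' : (y : ℝ) ^ 2 ≤ x j * (2 ^ 2 ^ Q.card *
      (((σ + j : ℕ) + 1) * x (j + 1) + N ^ 2 * A + ((σ + j : ℕ) + 2) ^ 2 * x (j + 2))) := by
    have h := (Nat.cast_le (α := ℝ)).2 h2
    simp only [Nat.cast_add, Nat.cast_mul, Nat.cast_pow, Nat.cast_one, Nat.cast_ofNat] at h ⊢
    exact h
  -- The coefficient grows with j, but the count vanishes once faces exceed d elements, so a
  -- constant suffices.
  have hcoef : ((σ + j : ℕ) + 1) * x (j + 1) ≤ ((d : ℝ) + 2) ^ 2 * x (j + 1) := by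
    rcases le_or_gt (σ + (j + 1)) d with h | h
    · refine mul_le_mul_of_nonneg_right ?_ (hx0 _)
      have h' : ((σ + j : ℕ) : ℝ) + 1 ≤ d := by exact_mod_cast h
      nlinarith [d.cast_nonneg (α := ℝ)]
    · have h0 : x (j + 1) = 0 := by
        rw [hx]
        exact Nat.cast_eq_zero.2 (card_homologyFaces_eq_zero k hd i Q h)
      rw [h0, mul_zero, mul_zero]
  have hcoef' : ((σ + j : ℕ) + 2) ^ 2 * x (j + 2) ≤ ((d : ℝ) + 2) ^ 2 * x (j + 2) := by
    rcases le_or_gt (σ + (j + 2)) d with h | h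
    · refine mul_le_mul_of_nonneg_right (pow_le_pow_left₀ (by positivity) ?_ 2) (hx0 _)
      have h' : ((σ + j : ℕ) : ℝ) + 2 ≤ d := by exact_mod_cast h
      linarith
    · have h0 : x (j + 2) = 0 := by
        rw [hx]
        exact Nat.cast_eq_zero.2 (card_homologyFaces_eq_zero k hd i Q h)
      rw [h0, mul_zero, mul_zero]
  have h3 : (y : ℝ) ^ 2 ≤ x j * (c * (x (j + 1) + C₀ * (N ^ σ * t ^ (j + 2)) + x (j + 2))) := by
    refine h2'.trans (mul_le_mul_of_nonneg_left ?_ (hx0 j))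
    rw [hc, mul_assoc]
    refine mul_le_mul (pow_le_pow_right₀ one_le_two (Nat.pow_le_pow_right two_pos hQ)) ?_
      (add_nonneg (add_nonneg (mul_nonneg (by positivity) (hx0 _)) (by positivity))
        (mul_nonneg (by positivity) (hx0 _))) (by positivity)
    have h4 : N ^ 2 * (A : ℝ) ≤ ((d : ℝ) + 2) ^ 2 * (C₀ * (N ^ σ * t ^ (j + 2))) :=
      hAle.trans (le_mul_of_one_le_left (by positivity) hd2)
    linarith
  refine ⟨y / (N ^ σ * t ^ (j + 1)), div_nonneg (Nat.cast_nonneg _) (hden _).le, ?_, ?_⟩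
  · rw [hr]
    dsimp only
    rw [div_le_iff₀ (hden _), add_mul, div_mul_cancel₀ _ (hden _).ne']
    linarith
  · rw [div_pow, div_le_iff₀ (by positivity)]
    refine h3.trans ?_
    rw [hxr j, hxr (j + 1), hxr (j + 2)]
    have h5 : r (j + 1) * (N ^ σ * t ^ (j + 1)) ≤ r (j + 1) * (N ^ σ * t ^ (j + 2)) := by
      refine mul_le_mul_of_nonneg_left (mul_le_mul_of_nonneg_left ?_ hP0.le) (hr0 _)
      exact pow_le_pow_right₀ ht (by omega)
    calc _ ≤ r j * (N ^ σ * t ^ j) * (c * (r (j + 1) * (N ^ σ * t ^ (j + 2)) +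
          C₀ * (N ^ σ * t ^ (j + 2)) + r (j + 2) * (N ^ σ * t ^ (j + 2)))) := by
          refine mul_le_mul_of_nonneg_left (mul_le_mul_of_nonneg_left ?_ (by linarith))
            (mul_nonneg (hr0 j) (hden j).le)
          linarith
      _ = _ := by ring

/-- The identity t² = N s between consecutive rates is what halves the gap in the exponent. -/
theorem rpow_growth_rate (N : ℝ) (hN : 1 ≤ N) (σ : ℕ) :
    1 ≤ N ^ (1 - 1 / 2 ^ σ : ℝ) ∧ N ^ (1 - 1 / 2 ^ σ : ℝ) ≤ N ∧
      (N ^ (1 - 1 / 2 ^ (σ + 1) : ℝ)) ^ 2 = N * N ^ (1 - 1 / 2 ^ σ : ℝ) := by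
  have h1 : (1 : ℝ) / 2 ^ σ ≤ 1 := div_le_one_of_le₀ (one_le_pow₀ one_le_two) (by positivity)
  have h0 : (0 : ℝ) ≤ 1 / 2 ^ σ := by positivity
  refine ⟨Real.one_le_rpow hN (by linarith), ?_, ?_⟩
  · calc N ^ (1 - 1 / 2 ^ σ : ℝ) ≤ N ^ (1 : ℝ) := Real.rpow_le_rpow_of_exponent_le hN (by linarith)
      _ = N := Real.rpow_one N
  · have hN0 : 0 < N := by linarith
    rw [← Real.rpow_natCast, ← Real.rpow_mul hN0.le]
    nth_rewrite 2 [← Real.rpow_one N]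
    rw [← Real.rpow_add hN0]
    congr 1
    rw [pow_succ]
    push_cast
    field_simp
    ring

theorem exists_card_homologyFaces_le_of_girth (p d σ q : ℕ) (h : q + σ + 1 = p) :
    ∃ C : ℝ, 1 ≤ C ∧ ∀ (k : Type u) [Field k] (V : Type v) [Fintype V] [LinearOrder V] [Nonempty V]
      (Γ : FaceComplex V), (∀ F ∈ Γ, F.card ≤ d) →
      2 * (p : ℕ∞) < Γ.girth k ((p : ℤ) - 1) →
      ∀ (j : ℕ) (Q : Finset V), Q.card ≤ 2 * q →
        ((Γ.homologyFaces k ((q : ℤ) - 1) Q (σ + j)).card : ℝ) ≤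
          C * ((Fintype.card V : ℝ) ^ σ *
            ((Fintype.card V : ℝ) ^ (1 - 1 / 2 ^ σ : ℝ)) ^ j) := by
  induction σ generalizing q with
  | zero =>
    -- Here q = p - 1, so the window 2q + 2 in the next degree is exactly 2p, where the girth leaves
    -- no faces.
    obtain ⟨C, hC1, hC⟩ := exists_card_homologyFaces_le.{u, v} d 0 (2 * q) le_rfl
    refine ⟨C, hC1, fun k _ V _ _ _ Γ hd hg => ?_⟩
    have hN : (1 : ℝ) ≤ Fintype.card V := by exact_mod_cast Fintype.card_pos
    obtain ⟨ht, htN, -⟩ := rpow_growth_rate _ hN 0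
    refine hC k V Γ _ _ hd ht htN fun j Q hQ => ?_
    rw [homologyFaces_eq_empty_of_girth k (Q := Q)]
    · rw [Finset.card_empty, Nat.cast_zero, mul_zero]
      positivity
    · have h1 : (q : ℤ) - 1 + 1 = (p : ℤ) - 1 := by omega
      rw [h1]
      refine lt_of_le_of_lt ?_ hg
      have h2 : Q.card ≤ 2 * p := by omega
      exact_mod_cast h2
  | succ σ ih =>
    obtain ⟨C₀, hC₀, hB⟩ := ih (q + 1) (by omega)
    obtain ⟨C, hC1, hC⟩ := exists_card_homologyFaces_le.{u, v} d (σ + 1) (2 * q) hC₀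
    refine ⟨C, hC1, fun k _ V _ _ _ Γ hd hg => ?_⟩
    have hN : (1 : ℝ) ≤ Fintype.card V := by exact_mod_cast Fintype.card_pos
    obtain ⟨ht, htN, -⟩ := rpow_growth_rate _ hN (σ + 1)
    obtain ⟨hs, hsN, hts⟩ := rpow_growth_rate _ hN σ
    refine hC k V Γ _ _ hd ht htN fun j Q hQ => ?_
    have h1 : (q : ℤ) - 1 + 1 = ((q + 1 : ℕ) : ℤ) - 1 := by push_cast; ring
    rw [h1, show σ + 1 + j = σ + (j + 1) by omega]
    have h2 := hB k V Γ hd hg (j + 1) Q (by omega)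
    set N : ℝ := (Fintype.card V : ℝ)
    set t := N ^ (1 - 1 / 2 ^ (σ + 1) : ℝ)
    set s := N ^ (1 - 1 / 2 ^ σ : ℝ)
    have hst : s ≤ t := by
      refine le_of_sq_le_sq ?_ (by linarith)
      rw [hts, sq]
      exact mul_le_mul_of_nonneg_right hsN (by linarith)
    calc _ ≤ N ^ 2 * (C₀ * (N ^ σ * s ^ (j + 1))) := mul_le_mul_of_nonneg_left h2 (by positivity)
      _ = C₀ * (N ^ (σ + 1) * (s ^ j * (N * s))) := by ring
      _ ≤ C₀ * (N ^ (σ + 1) * (t ^ j * (N * s))) := by gcongr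
      _ = C₀ * (N ^ (σ + 1) * t ^ (j + 2)) := by rw [← hts, pow_add t j 2]

end FaceComplex

/-! ### The exponent and the final bound -/

theorem girthExponent_two_self (p : ℕ) :
    girthExponent 2 (p + 2) (p + 2) = ((p + 2 : ℕ) : ℝ) - 1 / 2 ^ (p + 1) := by
  induction p with
  | zero => norm_num [girthExponent, Finset.sum_range_succ]
  | succ p ih =>
    have h : girthExponent 2 (p + 3) (p + 2) = (p : ℝ) + 2 := by
      rw [show p + 2 = (p + 1) + 1 from rfl, girthExponent, if_pos (by omega)]
    rw [show p + 1 + 2 = p + 3 from rfl]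
    nth_rewrite 2 [show p + 3 = (p + 2) + 1 from rfl]
    rw [girthExponent, if_neg (by omega), ih, h]
    push_cast
    field_simp
    ring

theorem mainTheorem4 (p d : ℕ) (hp : 2 ≤ p) :
    (p : ℝ) - 1 / 2 ^ (p - 1) = girthExponent 2 p p ∧
    ∃ C : ℝ, ∀ (k : Type*) [Field k] (V : Type*) [Fintype V] [LinearOrder V]
      (Γ : FaceComplex V),
      Γ.HasDim ((d : ℤ) - 1) →
      2 * (p : ℕ∞) < Γ.girth k ((p : ℤ) - 1) →
      (Γ.faceNumber ((p : ℤ) - 1) : ℝ) ≤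
        C * (Fintype.card V : ℝ) ^ ((p : ℝ) - 1 / 2 ^ (p - 1)) := by
  obtain ⟨p, rfl⟩ := Nat.exists_eq_add_of_le' hp
  refine ⟨(girthExponent_two_self p).symm, ?_⟩
  obtain ⟨C, hC1, hC⟩ := FaceComplex.exists_card_homologyFaces_le_of_girth (p + 2) d (p + 1) 0
    (by omega)
  refine ⟨C, fun k _ V _ _ Γ hdim hg => ?_⟩
  have hd : ∀ F ∈ Γ, F.card ≤ d := fun F hF => by
    have := hdim.2 ⟨F, hF, rfl⟩
    omega
  have hsub : Γ.facesOfDim (((p + 2 : ℕ) : ℤ) - 1) ⊆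
      (Γ.homologyFaces k (-1) ∅ (p + 2) : Set (Finset V)) := by
    rintro F ⟨hF, hcard⟩
    have h : F.card = p + 2 := by omega
    rw [← h]
    exact FaceComplex.mem_homologyFaces_empty k hF
  have hcard : Γ.faceNumber (((p + 2 : ℕ) : ℤ) - 1) ≤
      (Γ.homologyFaces k (-1) ∅ (p + 2)).card := by
    rw [← Set.ncard_coe_finset]
    exact Set.ncard_le_ncard hsub (Finset.finite_toSet _)
  -- Adding real exponents below needs a positive number of vertices.
  rcases isEmpty_or_nonempty V with hV | hV
  · have h0 : (Γ.homologyFaces k (-1) ∅ (p + 2)).card ≤ 0 := by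
      simpa using FaceComplex.card_homologyFaces_le_pow k Γ (-1) ∅ (p + 2)
    rw [Nat.le_zero.1 (hcard.trans h0), Nat.cast_zero]
    positivity
  · have hN : (0 : ℝ) < Fintype.card V := by exact_mod_cast Fintype.card_pos
    have h := hC k V Γ hd hg 1 ∅ (by simp)
    rw [pow_one, ← Real.rpow_natCast, ← Real.rpow_add hN] at h
    refine (Nat.cast_le.2 hcard).trans (h.trans_eq ?_)
    congr 2
    rw [show p + 2 - 1 = p + 1 from rfl]
    push_cast
    ring
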